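/- \textbf{Setting.} Let $A\in\mathbb{R}^{n_x\times n_x}$, $B\in\mathbb{R}^{n_x\times n_u}$, $x_{\rm init}\in\mathbb{R}^{n_x}$, $\rho_{\min},\rho_{\max}\in\mathbb{R}$, and $N\ge 0$. Let $m:\mathbb{R}^{n_x}\to\mathbb{R}$ and $g:\mathbb{R}^{n_u}\to\mathbb{R}$ be convex, let $l_1,\dots,l_N:\mathbb{R}\to\mathbb{R}$ be convex on $[\rho_{\min},\infty)$, and let $G:\mathbb{R}^{n_x}\to\mathbb{R}^{n_G}$ be affine. For a real $n_x\times n_x$ matrix $A'$ let $\mathcal P(A')$ be the problem $$\min_{x,u,\sigma}\; m(x_{N+1})+\sum_{i=1}^N l_i(\sigma_i)\quad\text{s.t.}\quad x_{i+1}=A'x_i+Bu_i,\ \ \rho_{\min}\le\sigma_i\le\rho_{\max},\ \ g(u_i)\le\sigma_i\ (1\le i\le N),\ \ x_1=x_{\rm init},\ \ G(x_{N+1})=0,$$ where $x_i\in\mathbb{R}^{n_x}$ for $1\le i\le N+1$, and $u_i\in\mathbb{R}^{n_u}$, $\sigma_i\in\mathbb{R}$ for $1\le i\le N$. For $z=(x,u,\sigma)$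 let $H(z)=0$ collect all equality constraints of $\mathcal P(A)$ (dynamics, initial condition, boundary condition), and let $\tilde V$ be the set of all $z$ with $\rho_{\min}\le\sigma_i\le\rho_{\max}$ and $g(u_i)\le\sigma_i$ for all $i$. \textbf{Assumptions.} (1) $m$ is $C^1$; each $l_i$ is $C^1$ and strictly increasing on $[\rho_{\min},\infty)$; the set of $u=(u_1,\dots,u_N)$ with $g(u_i)\le\rho_{\min}$ for all $i$ is nonempty, and the set of $u$ with $g(u_i)\le\rho_{\max}$ for all $i$ is compact. (2) $\operatorname{rank}(B, AB,\dots,A^{n_x-1}B)=n_x$. (3) The (constant) Jacobian of $H$ has full row rank. (4) There is a $z$ in the interior of $\tilde V$ with $H(z)=0$. (5) $\mathcal P(A)$ is normal: for every optimal solution of $\mathcal P(A)$, either $\sigma_i>\rho_{\min}$ for some $i$, or $x_{N+1}$ is not a minimizer of $m(y)$ subject to $G(y)=0$. \textbf{Perturbation.} Let $A=Q^{-1}JQ$ be a Jordan form of $A$ over $\mathbb{C}$, and let $\lambda_1,\dots,\lambda_d$ be the distinct eigenvalues of $A$ with nonnegative imaginary part, so that each pair of conjugate non-real eigenvalues is listed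 once (if all eigenvalues of $A$ are real, these are all its distinct eigenvalues). For $q\in\mathbb{R}^d$ let $\tilde J(q)$ be the matrix obtained from $J$ by replacing each diagonal entry equal to $\lambda_k$ by $\lambda_k+q_k$ and each diagonal entry equal to $\overline{\lambda_k}$ by $\overline{\lambda_k}+q_k$, all other entries being kept. Let $\tilde A(q)=Q^{-1}\tilde J(q)Q$, which is a real matrix. \textbf{Theorem.} Under assumptions (1)--(5) there is an $\epsilon>0$ such that $\mathcal P(\tilde A(q))$ has an optimal solution for every $q\in[-\epsilon,\epsilon]^d$ and, if $q$ is uniformly distributed over the cube $[-\epsilon,\epsilon]^d$, then with probability zero there is an optimal solution $(x,u,\sigma)$ of $\mathcal P(\tilde A(q))$ for which the constraint $\rho_{\min}\le g(u_i)\le\rho_{\max}$ is violated at more than $n_x-1$ of the grid points $i\in\{1,\dots,N\}$. -/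

import Mathlib

open scoped BigOperators ComplexConjugate

noncomputable section

/-- Data of the relaxed discrete problem: state dimension `n`, control dimension `nu`,
`nG` boundary equations and `N` grid points for the control (bare data, no laws). -/
structure RelaxedProblem (n nu nG N : ℕ) where
  A : Matrix (Fin n) (Fin n) ℝ
  B : Matrix (Fin n) (Fin nu) ℝ
  m : (Fin n → ℝ) → ℝ
  l : Fin N → ℝ → ℝ
  g : (Fin nu → ℝ) → ℝ
  G : (Fin n → ℝ) →ᵃ[ℝ] (Fin nG → ℝ)
  rhoMin : ℝ
  rhoMax : ℝ
  xInit : Fin n → ℝ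

/-- The decision variable `z = (x, u, σ)`, with `N + 1` states, `N` controls and `N` slacks. -/
abbrev Traj (n nu N : ℕ) : Type :=
  (Fin (N + 1) → Fin n → ℝ) × (Fin N → Fin nu → ℝ) × (Fin N → ℝ)

namespace RelaxedProblem

variable {n nu nG N : ℕ}

/-- Objective `m (x_{N+1}) + ∑ i, l_i (σ_i)`. -/
def objective (P : RelaxedProblem n nu nG N) (z : Traj n nu N) : ℝ :=
  P.m (z.1 (Fin.last N)) + ∑ i, P.l i (z.2.2 i)

/-- All equality constraints in the form `H z = 0`:
the dynamics, the initial condition and the boundary condition. -/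
def H (P : RelaxedProblem n nu nG N) (z : Traj n nu N) :
    (Fin N → Fin n → ℝ) × (Fin n → ℝ) × (Fin nG → ℝ) :=
  (fun i => P.A.mulVec (z.1 i.castSucc) + P.B.mulVec (z.2.1 i) - z.1 i.succ,
    z.1 0 - P.xInit,
    P.G (z.1 (Fin.last N)))

/-- The pointwise constraint set `V` for `(u_i, σ_i)`. -/
def V (P : RelaxedProblem n nu nG N) : Set ((Fin nu → ℝ) × ℝ) :=
  {w | P.rhoMin ≤ w.2 ∧ w.2 ≤ P.rhoMax ∧ P.g w.1 ≤ w.2}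

/-- The inequality constraints on `z`: all `(u_i, σ_i)` lie in `V`. -/
def VTilde (P : RelaxedProblem n nu nG N) : Set (Traj n nu N) :=
  {z | ∀ i, (z.2.1 i, z.2.2 i) ∈ P.V}

def Feasible (P : RelaxedProblem n nu nG N) (z : Traj n nu N) : Prop :=
  P.H z = 0 ∧ z ∈ P.VTilde

/-- `z` is a (global) optimal solution of the relaxed problem. -/
def IsOptimal (P : RelaxedProblem n nu nG N) (z : Traj n nu N) : Prop :=
  P.Feasible z ∧ ∀ z', P.Feasible z' → P.objective z ≤ P.objective z'

/-- The convexity built into the problem. -/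
def IsConvex (P : RelaxedProblem n nu nG N) : Prop :=
  ConvexOn ℝ Set.univ P.m ∧ ConvexOn ℝ Set.univ P.g ∧
    ∀ i, ConvexOn ℝ (Set.Ici P.rhoMin) (P.l i)

/-- Smoothness, monotonicity and compactness assumption. -/
def RegularCompact (P : RelaxedProblem n nu nG N) : Prop :=
  (∀ i, ContDiffOn ℝ 1 (P.l i) (Set.Ici P.rhoMin)) ∧
  (∀ i, StrictMonoOn (P.l i) (Set.Ici P.rhoMin)) ∧
  ContDiff ℝ 1 P.m ∧
  {u : Fin N → Fin nu → ℝ | ∀ i, P.g (u i) ≤ P.rhoMin}.Nonempty ∧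
  IsCompact {u : Fin N → Fin nu → ℝ | ∀ i, P.g (u i) ≤ P.rhoMax}

/-- The block matrix `(B, A B, …, A ^ (n - 1) B)`. -/
def controllabilityMatrix (P : RelaxedProblem n nu nG N) :
    Matrix (Fin n) (Fin n × Fin nu) ℝ :=
  Matrix.of fun i p => (P.A ^ (p.1 : ℕ) * P.B) i p.2

def Controllable (P : RelaxedProblem n nu nG N) : Prop :=
  P.controllabilityMatrix.rank = n

/-- The Jacobian of the affine map `H` has full row rank. -/
def FullRowRank (P : RelaxedProblem n nu nG N) : Prop :=
  ∀ z, Function.Surjective (fderiv ℝ P.H z)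

def Slater (P : RelaxedProblem n nu nG N) : Prop :=
  ∃ z ∈ interior P.VTilde, P.H z = 0

/-- `y` minimizes `m` subject to `G y = 0`. -/
def SolvesTerminal (P : RelaxedProblem n nu nG N) (y : Fin n → ℝ) : Prop :=
  P.G y = 0 ∧ ∀ y', P.G y' = 0 → P.m y ≤ P.m y'

/-- Normal case: every optimal solution has some `σ_i > ρ_min`, or a final state that does not
minimize `m` subject to `G = 0`. -/
def Normal (P : RelaxedProblem n nu nG N) : Prop :=
  ∀ z, P.IsOptimal z →
    (∃ i, P.rhoMin < z.2.2 i) ∨ ¬ P.SolvesTerminal (z.1 (Fin.last N))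

/-- The grid points at which the original constraint `ρ_min ≤ g (u_i) ≤ ρ_max` is violated. -/
def violations (P : RelaxedProblem n nu nG N) (z : Traj n nu N) : Set (Fin N) :=
  {i | ¬ (P.rhoMin ≤ P.g (z.2.1 i) ∧ P.g (z.2.1 i) ≤ P.rhoMax)}

/-- The same problem with the dynamics matrix replaced. -/
def withDynamics (P : RelaxedProblem n nu nG N) (A' : Matrix (Fin n) (Fin n) ℝ) :
    RelaxedProblem n nu nG N :=
  { P with A := A' }

end RelaxedProblem

/-- Jordan matrices: upper bidiagonal, with superdiagonal entries `0` or `1`, and `1` only between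
equal diagonal entries (that is, block diagonal with Jordan blocks). -/
def IsJordanMatrix {n : ℕ} (J : Matrix (Fin n) (Fin n) ℂ) : Prop :=
  (∀ i j : Fin n, i ≠ j → (i : ℕ) + 1 ≠ j → J i j = 0) ∧
  (∀ i j : Fin n, (i : ℕ) + 1 = j → J i j = 0 ∨ (J i j = 1 ∧ J i i = J j j))

/-- A Jordan form `A = Q⁻¹ J Q` of a real matrix (over `ℂ`), with a list `lam` without repetition
of the distinct eigenvalues of `A`, where each pair of conjugate non-real eigenvalues is
represented by its member with positive imaginary part. -/
structure JordanForm {n : ℕ} (A : Matrix (Fin n) (Fin n) ℝ) (d : ℕ) where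
  Q : Matrix (Fin n) (Fin n) ℂ
  J : Matrix (Fin n) (Fin n) ℂ
  isUnit_Q : IsUnit Q
  isJordan : IsJordanMatrix J
  eq_conj : A.map Complex.ofReal = Q⁻¹ * J * Q
  lam : Fin d → ℂ
  lam_injective : Function.Injective lam
  range_lam : Set.range lam = {μ | μ ∈ spectrum ℂ (A.map Complex.ofReal) ∧ 0 ≤ μ.im}

namespace JordanForm

variable {n d : ℕ} {A : Matrix (Fin n) (Fin n) ℝ}

open Classical in
/-- The shift of the `i`-th diagonal entry of `J`: it is `q k` for the only `k` such that this
entry is `lam k` or its conjugate. -/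
def shift (F : JordanForm A d) (q : Fin d → ℝ) (i : Fin n) : ℝ :=
  ∑ k, if F.J i i = F.lam k ∨ F.J i i = conj (F.lam k) then q k else 0

/-- `J` with shifted eigenvalues; all off-diagonal entries are kept. -/
def shiftedJ (F : JordanForm A d) (q : Fin d → ℝ) : Matrix (Fin n) (Fin n) ℂ :=
  F.J + Matrix.diagonal fun i => ((F.shift q i : ℝ) : ℂ)

/-- The perturbed real matrix `Q⁻¹ * shiftedJ q * Q`; this product is real by
`map_perturb` below, so that taking real parts loses nothing. -/
def perturb (F : JordanForm A d) (q : Fin d → ℝ) : Matrix (Fin n) (Fin n) ℝ :=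
  (F.Q⁻¹ * F.shiftedJ q * F.Q).map Complex.re

theorem shift_of_eq (F : JordanForm A d) (q : Fin d → ℝ) (i : Fin n) (k : Fin d)
    (h : F.J i i = F.lam k ∨ F.J i i = conj (F.lam k)) : F.shift q i = q k := by
  have him : ∀ k, 0 ≤ (F.lam k).im := fun k => by
    have := F.range_lam ▸ Set.mem_range_self (f := F.lam) k
    exact this.2
  unfold shift
  rw [Finset.sum_eq_single k]
  · rw [if_pos h]
  · intro k' _ hk'
    rw [if_neg]
    intro h'
    apply hk'
    apply F.lam_injective
    have h1 := him k
    have h2 := him k'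
    rcases h with h | h <;> rcases h' with h' | h' <;> rw [h] at h' <;>
      have e1 := congrArg Complex.re h' <;> have e2 := congrArg Complex.im h' <;>
      (try simp only [Complex.conj_re, Complex.conj_im] at e1 e2) <;>
      apply Complex.ext <;> linarith
  · intro hk
    exact absurd (Finset.mem_univ k) hk

theorem shift_congr (F : JordanForm A d) (q : Fin d → ℝ) (i j : Fin n)
    (h : conj (F.J i i) = F.J j j) : F.shift q i = F.shift q j := by
  unfold shift
  refine Finset.sum_congr rfl fun k _ => ?_
  congr 1
  rw [← h]
  apply propext
  constructor
  · rintro (h | h)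
    · right; rw [h]
    · left; rw [h, Complex.conj_conj]
  · rintro (h | h)
    · right; rw [← h, Complex.conj_conj]
    · left; exact (starRingEnd ℂ).injective h

theorem intertwine_zero {J R : Matrix (Fin n) (Fin n) ℂ} (hJ : IsJordanMatrix J)
    (hR : J.map conj * R = R * J) :
    ∀ (k : ℕ) (i j : Fin n), (j : ℕ) + (n - i) ≤ k → conj (J i i) ≠ J j j → R i j = 0 := by
  intro k
  induction k with
  | zero => intro i j h; have := i.2; omega
  | succ k ih =>
    intro i j hk hne
    have e := congrFun (congrFun hR i) j
    rw [Matrix.mul_apply, Matrix.mul_apply] at e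
    have e1 : ∑ x, J.map conj i x * R x j = conj (J i i) * R i j := by
      rw [Finset.sum_eq_single i]
      · simp
      · intro x _ hx
        by_cases hs : (i : ℕ) + 1 = x
        · rcases hJ.2 i x hs with h0 | ⟨_, h1⟩
          · simp [h0]
          · rw [ih x j (by have := x.2; omega) (h1 ▸ hne), mul_zero]
        · simp [hJ.1 i x (Ne.symm hx) hs]
      · intro h; exact absurd (Finset.mem_univ i) h
    have e2 : ∑ x, R i x * J x j = R i j * J j j := by
      rw [Finset.sum_eq_single j]
      · intro x _ hx
        by_cases hs : (x : ℕ) + 1 = j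
        · rcases hJ.2 x j hs with h0 | ⟨_, h1⟩
          · simp [h0]
          · rw [ih i x (by omega) (h1 ▸ hne), zero_mul]
        · simp [hJ.1 x j hx hs]
      · intro h; exact absurd (Finset.mem_univ j) h
    rw [e1, e2] at e
    have : (conj (J i i) - J j j) * R i j = 0 := by rw [sub_mul, e]; ring
    exact (mul_eq_zero.mp this).resolve_left (sub_ne_zero.mpr hne)

/-- The perturbed matrix is `Q⁻¹ * shiftedJ q * Q`. -/
theorem map_perturb (F : JordanForm A d) (q : Fin d → ℝ) :
    (F.perturb q).map Complex.ofReal = F.Q⁻¹ * F.shiftedJ q * F.Q := by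
  have hdet : IsUnit F.Q.det := (Matrix.isUnit_iff_isUnit_det _).mp F.isUnit_Q
  set c : Matrix (Fin n) (Fin n) ℂ →+* Matrix (Fin n) (Fin n) ℂ :=
    (starRingEnd ℂ).mapMatrix with hc
  set D : Matrix (Fin n) (Fin n) ℂ := Matrix.diagonal fun i => ((F.shift q i : ℝ) : ℂ) with hD
  set Ac := A.map Complex.ofReal with hAc
  have hA : Ac = F.Q⁻¹ * F.J * F.Q := F.eq_conj
  have hcA : c Ac = Ac := by
    ext i j; simp [hc, hAc]
  have hcD : c D = D := by
    ext i j
    by_cases h : i = j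
    · subst h; simp [hc, hD]
    · simp [hc, hD, h]
  have hQA : F.Q * Ac = F.J * F.Q := by
    rw [hA, ← mul_assoc, ← mul_assoc, Matrix.mul_nonsing_inv _ hdet, one_mul]
  have hQA' : c F.Q * Ac = c F.J * c F.Q := by
    have := congrArg c hQA
    rwa [map_mul, map_mul, hcA] at this
  set R := c F.Q * F.Q⁻¹ with hRdef
  have hRQ : R * F.Q = c F.Q := by
    rw [hRdef, mul_assoc, Matrix.nonsing_inv_mul _ hdet, mul_one]
  have hR : c F.J * R = R * F.J := by
    have h1 : Ac * F.Q⁻¹ = F.Q⁻¹ * F.J := by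
      rw [hA, mul_assoc, Matrix.mul_nonsing_inv _ hdet, mul_one]
    rw [hRdef, ← mul_assoc, ← hQA', mul_assoc, h1, ← mul_assoc]
  have hDR : D * R = R * D := by
    ext i j
    rw [hD, Matrix.diagonal_mul, Matrix.mul_diagonal]
    by_cases h : conj (F.J i i) = F.J j j
    · rw [F.shift_congr q i j h, mul_comm]
    · rw [intertwine_zero F.isJordan hR _ i j le_rfl h]; simp
  have hcQ : IsUnit (c F.Q) := F.isUnit_Q.map c
  have hM : c (F.Q⁻¹ * D * F.Q) = F.Q⁻¹ * D * F.Q := by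
    have h1 : F.Q * (F.Q⁻¹ * D * F.Q) = D * F.Q := by
      rw [← mul_assoc, ← mul_assoc, Matrix.mul_nonsing_inv _ hdet, one_mul]
    have h2 : c F.Q * c (F.Q⁻¹ * D * F.Q) = D * c F.Q := by
      rw [← map_mul, h1, map_mul, hcD]
    have h3 : c F.Q * (F.Q⁻¹ * D * F.Q) = D * c F.Q := by
      rw [← hRQ, mul_assoc, h1, ← mul_assoc, ← mul_assoc, hDR]
    exact hcQ.mul_left_cancel (h2.trans h3.symm)
  have hall : c (F.Q⁻¹ * F.shiftedJ q * F.Q) = F.Q⁻¹ * F.shiftedJ q * F.Q := by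
    have : F.Q⁻¹ * F.shiftedJ q * F.Q = Ac + F.Q⁻¹ * D * F.Q := by
      rw [shiftedJ, mul_add, add_mul, ← hA]
    rw [this, map_add, hcA, hM]
  ext i j
  have := congrFun (congrFun hall i) j
  simp only [hc, RingHom.mapMatrix_apply, Matrix.map_apply] at this
  simp only [perturb, Matrix.map_apply]
  exact Complex.conj_eq_iff_re.mp this

end JordanForm

/-- The cube `ε 𝔻 = [-ε, ε] ^ d`. -/
def cube (d : ℕ) (ε : ℝ) : Set (Fin d → ℝ) :=
  {q | ∀ k, -ε ≤ q k ∧ q k ≤ ε}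

/-- The uniform distribution on the cube `ε 𝔻`. -/
def uniformCube (d : ℕ) (ε : ℝ) : MeasureTheory.Measure (Fin d → ℝ) :=
  ProbabilityTheory.cond MeasureTheory.volume (cube d ε)

end

open scoped BigOperators ComplexConjugate

noncomputable section

/-! The maximum principle (`IsOptimal.exists_adjoint`) gives, for an optimal solution, a vector η
such that each (u_i, σ_i) minimizes ηᵀ A^(N-1-i) B v + l_i(s) over `V`, with i counted from 0. A
violation at i forces g(u_i) < σ_i, so u_i can move freely in every direction and ηᵀ A^(N-1-i) B = 0
(`eq_zero_of_violation`). If this happens at n grid points whose blocks A^(N-1-i) B jointly span the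
state space, then η = 0. In that case every slack sits at ρ_min and the final state minimizes m
subject to G = 0, which normality excludes (`IsOptimal.gramDet_eq_zero`).

It remains to see that n distinct powers span for almost every perturbation. Adding the same s to
all q_k adds sI to the matrix, so on lines parallel to (1, …, 1) the Gram determinant is a
polynomial in s. It is not the zero polynomial: with t = 1/s, finite differences of the powers (1 +
tA)^(v_i) recover A^r B to leading order for all r < n, and (A, B) is controllable. Each such line
therefore meets the bad set in finitely many points, and Fubini makes that set null
(`JordanForm.ae_gramDet_ne_zero`).

Controllability, Slater's condition with surjectivity of the terminal constraint, and normality all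
persist for dynamics matrices near A (`eventually_controlSlater`, `eventually_not_abnormal`). This
fixes ε. -/

/-! ### Gram determinants and powers of shifted matrices. -/

/-- The determinant of the Gramian `∑ i, M i * (M i)ᵀ` of a finite family of matrices. -/
def gramDet {ι R : Type*} [CommRing R] [Fintype ι] {n p : ℕ} (M : ι → Matrix (Fin n) (Fin p) R) :
    R :=
  (∑ i, M i * (M i).transpose).det

/-- The quadratic form of the Gramian at η is the sum of the squared norms of the rows ηᵀ M_i. Joint
spanning thus becomes the non-vanishing of a single polynomial in the entries. -/
theorem gramDet_ne_zero_iff {ι : Type*} [Fintype ι] {n p : ℕ}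
    (M : ι → Matrix (Fin n) (Fin p) ℝ) :
    gramDet M ≠ 0 ↔ ∀ η : Fin n → ℝ, (∀ i, Matrix.vecMul η (M i) = 0) → η = 0 := by
  unfold gramDet
  constructor
  · intro h η hη
    refine Matrix.eq_zero_of_vecMul_eq_zero h ?_
    rw [Matrix.vecMul_sum]
    refine Finset.sum_eq_zero fun i _ => ?_
    rw [← Matrix.vecMul_vecMul, hη i, Matrix.zero_vecMul]
  · intro h h0
    obtain ⟨η, hne, hη⟩ := Matrix.exists_vecMul_eq_zero_iff.mpr h0
    refine hne (h η fun i => ?_)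
    have h1 : ∑ i, dotProduct (Matrix.vecMul η (M i)) (Matrix.vecMul η (M i)) = 0 := by
      have := congrArg (fun w => dotProduct w η) hη
      simp only [zero_dotProduct, Matrix.vecMul_sum, sum_dotProduct] at this
      rw [← this]
      refine Finset.sum_congr rfl fun i _ => ?_
      rw [← Matrix.vecMul_vecMul, Matrix.vecMul_transpose, ← Matrix.dotProduct_mulVec,
        dotProduct_comm]
    have h2 : ∀ i ∈ Finset.univ,
        0 ≤ dotProduct (Matrix.vecMul η (M i)) (Matrix.vecMul η (M i)) :=
      fun i _ => Finset.sum_nonneg fun j _ => mul_self_nonneg _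
    exact dotProduct_self_eq_zero.mp ((Finset.sum_eq_zero_iff_of_nonneg h2).mp h1 i
      (Finset.mem_univ i))

theorem continuous_gramDet {ι X : Type*} [Fintype ι] [TopologicalSpace X] {n p : ℕ}
    {M : X → ι → Matrix (Fin n) (Fin p) ℝ} (hM : ∀ i, Continuous fun x => M x i) :
    Continuous fun x => gramDet (M x) := by
  unfold gramDet
  exact (continuous_finsetSum _ fun i _ => (hM i).matrix_mul (hM i).matrix_transpose).matrix_det

/-- Scaling column j by j! turns binomials into falling factorials, which are monic of degree j in v
i; the scaled determinant is a Vandermonde determinant with distinct nodes. -/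
theorem det_choose_ne_zero {n : ℕ} {v : Fin n → ℕ} (hv : Function.Injective v) :
    (Matrix.of fun i j : Fin n => (Nat.choose (v i) j : ℝ)).det ≠ 0 := by
  have h1 := Matrix.det_eval_matrixOfPolynomials_eq_det_vandermonde (fun i => (v i : ℝ))
    (fun i => descPochhammer ℝ i) (fun i => descPochhammer_natDegree ℝ i)
    (fun i => monic_descPochhammer ℝ i)
  have h2 : (Matrix.of fun i j : Fin n => (descPochhammer ℝ j).eval (v i : ℝ)) =
      Matrix.of fun i j : Fin n => ((Nat.factorial j : ℕ) : ℝ) * (Matrix.of fun i j : Fin n =>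
        (Nat.choose (v i) j : ℝ)) i j := by
    ext i j
    simp only [Matrix.of_apply]
    rw [descPochhammer_eval_eq_descFactorial, Nat.descFactorial_eq_factorial_mul_choose]
    push_cast; rfl
  rw [h2, Matrix.det_mul_row] at h1
  intro h0
  rw [h0, mul_zero] at h1
  exact Matrix.det_vandermonde_ne_zero_iff.mpr (Nat.cast_injective.comp hv) h1

/-- Finite-difference weights: combinations of `v`-th powers that extract a single binomial
coefficient. -/
theorem exists_choose_weights {n : ℕ} {v : Fin n → ℕ} (hv : Function.Injective v) :
    ∃ c : Fin n → Fin n → ℝ, ∀ r j : Fin n,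
      ∑ i, c r i * (Nat.choose (v i) j : ℝ) = if r = j then 1 else 0 := by
  set M := Matrix.of fun i j : Fin n => (Nat.choose (v i) j : ℝ) with hM
  refine ⟨fun r i => (M⁻¹ : Matrix (Fin n) (Fin n) ℝ) r i, fun r j => ?_⟩
  have h := congrFun (congrFun (Matrix.nonsing_inv_mul M
    (isUnit_iff_ne_zero.mpr (det_choose_ne_zero hv))) r) j
  rw [Matrix.mul_apply, Matrix.one_apply] at h
  exact h

/-- If `(A, B)` is controllable, then after some scalar shift of `A` any `n` distinct powers
`(A + s) ^ v i * B` span the whole space. -/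
theorem exists_shift_gramDet_ne_zero {n p : ℕ} {A : Matrix (Fin n) (Fin n) ℝ}
    {B : Matrix (Fin n) (Fin p) ℝ} (hAB : gramDet (fun i : Fin n => A ^ (i : ℕ) * B) ≠ 0)
    {v : Fin n → ℕ} (hv : Function.Injective v) :
    ∃ s : ℝ, gramDet (fun i : Fin n => (A + Matrix.scalar (Fin n) s) ^ v i * B) ≠ 0 := by
  obtain ⟨c, hc⟩ := exists_choose_weights hv
  -- A common summation bound, larger than n and than every exponent v i.
  set m : ℕ := n + 1 + ∑ i, v i with hm
  have hvm : ∀ i, v i + 1 ≤ m := fun i => by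
    have := Finset.single_le_sum (f := v) (fun _ _ => Nat.zero_le _) (Finset.mem_univ i)
    omega
  set a : Fin n → ℕ → ℝ := fun r j => ∑ i, c r i * (Nat.choose (v i) j : ℝ) with ha
  have ha1 : ∀ (r : Fin n) (j : ℕ), j < n → a r j = if (r : ℕ) = j then 1 else 0 := by
    intro r j hj
    have := hc r ⟨j, hj⟩
    simp only [Fin.ext_iff] at this
    exact this
  -- This extends t^(-r) ∑ c r i (1 + tA)^(v i) continuously to t = 0, where it equals A^r. The
  -- truncated exponent j - r is harmless, since a r j = 0 for j < r.
  set D : ℝ → Fin n → Matrix (Fin n) (Fin n) ℝ := fun t r =>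
    ∑ j ∈ Finset.range m, (a r j * t ^ (j - r)) • A ^ j with hD
  have hD0 : ∀ r, D 0 r = A ^ (r : ℕ) := by
    intro r
    have hr := r.2
    rw [hD]
    dsimp only
    rw [Finset.sum_eq_single_of_mem (r : ℕ) (Finset.mem_range.mpr (by omega))]
    · rw [ha1 r r hr]; simp
    · intro j _ hjr
      by_cases hjn : j < n
      · rw [ha1 r j hjn, if_neg (Ne.symm hjr)]; simp
      · rw [zero_pow (by omega)]; simp
  have hDt : ∀ (t : ℝ) (r : Fin n), t ^ (r : ℕ) • D t r = ∑ i, c r i • (1 + t • A) ^ v i := by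
    intro t r
    have h1 : ∀ i, (1 + t • A) ^ v i =
        ∑ j ∈ Finset.range m, ((Nat.choose (v i) j : ℝ) * t ^ j) • A ^ j := by
      intro i
      rw [add_comm, (Commute.one_right (t • A)).add_pow]
      rw [← Finset.sum_subset (Finset.range_subset_range.mpr (hvm i))]
      · refine Finset.sum_congr rfl fun j _ => ?_
        rw [one_pow, mul_one, smul_pow, mul_smul, Nat.cast_smul_eq_nsmul, nsmul_eq_mul,
          (Nat.cast_commute _ _).eq]
      · intro j _ hj
        rw [Nat.choose_eq_zero_of_lt (by simpa [Nat.lt_succ_iff] using hj)]; simp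
    simp_rw [h1, Finset.smul_sum, hD]
    rw [Finset.sum_comm, Finset.smul_sum]
    refine Finset.sum_congr rfl fun j _ => ?_
    rw [smul_smul, ← Finset.sum_congr rfl fun i _ => (smul_smul (c r i) _ (A ^ j)).symm,
      ← Finset.sum_smul]
    congr 1
    have h2 : ∑ i, c r i * ((Nat.choose (v i) j : ℝ) * t ^ j) = a r j * t ^ j := by
      rw [ha, Finset.sum_mul]
      exact Finset.sum_congr rfl fun i _ => (mul_assoc _ _ _).symm
    rw [h2]
    by_cases hjr : (r : ℕ) ≤ j
    · rw [mul_left_comm, ← pow_add, Nat.add_sub_cancel' hjr]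
    · rw [ha1 r j (by omega), if_neg (by omega)]; ring
  have hcont : Continuous fun t => gramDet (fun r => D t r * B) :=
    continuous_gramDet fun r => by
      refine Continuous.matrix_mul ?_ continuous_const
      exact continuous_finsetSum _ fun j _ => by fun_prop
  have hne : ∀ᶠ t in nhds (0 : ℝ), gramDet (fun r => D t r * B) ≠ 0 := by
    refine hcont.continuousAt.eventually_ne ?_
    simp only [hD0]
    exact hAB
  obtain ⟨t, ht, ht0⟩ := ((hne.filter_mono nhdsWithin_le_nhds).and
    (self_mem_nhdsWithin (a := (0 : ℝ)) (s := {0}ᶜ))).exists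
  have ht0 : t ≠ 0 := ht0
  refine ⟨t⁻¹, ?_⟩
  rw [gramDet_ne_zero_iff] at ht ⊢
  intro η hη
  refine ht η fun r => ?_
  have h3 : ∀ i, Matrix.vecMul η ((1 + t • A) ^ v i * B) = 0 := by
    intro i
    have : (1 + t • A) = t • (A + Matrix.scalar (Fin n) t⁻¹) := by
      rw [smul_add, show Matrix.scalar (Fin n) t⁻¹ = algebraMap ℝ _ t⁻¹ from rfl,
        Algebra.algebraMap_eq_smul_one, smul_smul, mul_inv_cancel₀ ht0,
        one_smul, add_comm]
    rw [this, smul_pow, Matrix.smul_mul, Matrix.vecMul_smul, hη i, smul_zero]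
  have h4 : t ^ (r : ℕ) • Matrix.vecMul η (D t r * B) = 0 := by
    rw [← Matrix.vecMul_smul, ← Matrix.smul_mul, hDt, Matrix.sum_mul, Matrix.vecMul_sum]
    refine Finset.sum_eq_zero fun i _ => ?_
    rw [Matrix.smul_mul, Matrix.vecMul_smul, h3, smul_zero]
  exact (smul_eq_zero.mp h4).resolve_left (pow_ne_zero _ ht0)

/-- The determinant is a polynomial in s, computed over the ring of polynomials, and the preceding
lemma supplies a point where it is nonzero. -/
theorem finite_shift_gramDet_eq_zero {n p : ℕ} {A : Matrix (Fin n) (Fin n) ℝ}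
    {B : Matrix (Fin n) (Fin p) ℝ} (hAB : gramDet (fun i : Fin n => A ^ (i : ℕ) * B) ≠ 0)
    {v : Fin n → ℕ} (hv : Function.Injective v) :
    {s : ℝ | gramDet (fun i : Fin n => (A + Matrix.scalar (Fin n) s) ^ v i * B) = 0}.Finite := by
  set AX : Matrix (Fin n) (Fin n) (Polynomial ℝ) :=
    A.map Polynomial.C + Matrix.scalar (Fin n) Polynomial.X
  set BX : Matrix (Fin n) (Fin p) (Polynomial ℝ) := B.map Polynomial.C
  set q : Polynomial ℝ := gramDet fun i : Fin n => AX ^ v i * BX with hq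
  have hA : ∀ s : ℝ, AX.map (Polynomial.evalRingHom s) = A + Matrix.scalar (Fin n) s := by
    intro s
    ext i j
    by_cases h : i = j <;> simp [AX, Matrix.scalar_apply, h]
  have hB : ∀ s : ℝ, BX.map (Polynomial.evalRingHom s) = B := by
    intro s
    ext i j
    simp [BX]
  have hev : ∀ s : ℝ, q.eval s =
      gramDet (fun i : Fin n => (A + Matrix.scalar (Fin n) s) ^ v i * B) := by
    intro s
    rw [← Polynomial.coe_evalRingHom, hq, gramDet, RingHom.map_det, gramDet, map_sum]
    congr 1
    refine Finset.sum_congr rfl fun i _ => ?_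
    have h1 : (AX ^ v i * BX).map (Polynomial.evalRingHom s) =
        (A + Matrix.scalar (Fin n) s) ^ v i * B := by
      rw [Matrix.map_mul, hB, ← RingHom.mapMatrix_apply, map_pow, RingHom.mapMatrix_apply, hA]
    rw [RingHom.mapMatrix_apply, Matrix.map_mul, Matrix.transpose_map, h1]
  have hq0 : q ≠ 0 := by
    obtain ⟨s, hs⟩ := exists_shift_gramDet_ne_zero hAB hv
    rintro h
    rw [← hev, h] at hs
    simp at hs
  refine (Polynomial.finite_setOfPred_isRoot hq0).subset fun s hs => ?_
  rw [Set.mem_ofPred_eq, Polynomial.IsRoot, hev]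
  exact hs

theorem RelaxedProblem.Controllable.gramDet_ne_zero {n nu nG N : ℕ}
    {P : RelaxedProblem n nu nG N} (h : P.Controllable) :
    gramDet (fun i : Fin n => P.A ^ (i : ℕ) * P.B) ≠ 0 := by
  rw [gramDet_ne_zero_iff]
  intro η hη
  have h1 : LinearIndependent ℝ P.controllabilityMatrix.row := by
    rw [linearIndependent_iff_card_eq_finrank_span, Set.finrank,
      ← Matrix.rank_eq_finrank_span_row, h, Fintype.card_fin]
  have h2 := Matrix.vecMul_injective_iff.mpr h1
  apply h2
  dsimp only
  rw [Matrix.zero_vecMul]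
  ext ⟨i, j⟩
  exact congrFun (hη i) j

/-! ### The perturbed matrix as a function of q. -/

namespace JordanForm

variable {n d : ℕ} {A : Matrix (Fin n) (Fin n) ℝ}

theorem diagonal_mem_spectrum (F : JordanForm A d) (i : Fin n) :
    F.J i i ∈ spectrum ℂ (A.map Complex.ofReal) := by
  have hdet : IsUnit F.Q.det := (Matrix.isUnit_iff_isUnit_det _).mp F.isUnit_Q
  have h0 : (Matrix.scalar (Fin n) (F.J i i) - F.J).det = 0 := by
    rw [Matrix.det_of_isUpperTriangular]
    · exact Finset.prod_eq_zero (Finset.mem_univ i) (by simp)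
    · intro a b hab
      have hab : b < a := hab
      rw [Matrix.sub_apply, F.isJordan.1 a b hab.ne' (by have := Fin.lt_def.mp hab; omega),
        Matrix.scalar_apply, Matrix.diagonal_apply_ne _ hab.ne', sub_zero]
  rw [spectrum.mem_iff, Matrix.isUnit_iff_isUnit_det, isUnit_iff_ne_zero, not_not, F.eq_conj]
  have h1 : algebraMap ℂ (Matrix (Fin n) (Fin n) ℂ) (F.J i i) - F.Q⁻¹ * F.J * F.Q =
      F.Q⁻¹ * (Matrix.scalar (Fin n) (F.J i i) - F.J) * F.Q := by
    rw [mul_sub, sub_mul]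
    congr 1
    show algebraMap ℂ (Matrix (Fin n) (Fin n) ℂ) (F.J i i) =
      F.Q⁻¹ * algebraMap ℂ (Matrix (Fin n) (Fin n) ℂ) (F.J i i) * F.Q
    rw [← Algebra.commutes, mul_assoc, Matrix.nonsing_inv_mul _ hdet, mul_one]
  rw [h1, Matrix.det_mul, Matrix.det_mul, h0]
  ring

/-- The spectrum of a real matrix is closed under conjugation, so a diagonal entry or its conjugate
is listed. Hence no diagonal entry escapes the shift, which `perturb_add_const` needs. -/
theorem exists_lam_eq (F : JordanForm A d) (i : Fin n) :
    ∃ k, F.J i i = F.lam k ∨ F.J i i = conj (F.lam k) := by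
  have hs := F.diagonal_mem_spectrum i
  rcases le_total 0 (F.J i i).im with h | h
  · obtain ⟨k, hk⟩ : F.J i i ∈ Set.range F.lam := by rw [F.range_lam]; exact ⟨hs, h⟩
    exact ⟨k, Or.inl hk.symm⟩
  · obtain ⟨k, hk⟩ : conj (F.J i i) ∈ Set.range F.lam := by
      rw [F.range_lam]
      refine ⟨?_, by simpa using h⟩
      rw [spectrum.mem_iff, Matrix.isUnit_iff_isUnit_det] at hs ⊢
      have h1 : algebraMap ℂ (Matrix (Fin n) (Fin n) ℂ) (conj (F.J i i)) -
          A.map Complex.ofReal = (starRingEnd ℂ).mapMatrix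
            (algebraMap ℂ (Matrix (Fin n) (Fin n) ℂ) (F.J i i) - A.map Complex.ofReal) := by
        ext a b
        by_cases hab : a = b <;> simp [Matrix.algebraMap_matrix_apply, hab]
      rw [h1, ← RingHom.map_det]
      intro h2
      exact hs (by simpa using h2)
    exact ⟨k, Or.inr (by rw [hk, Complex.conj_conj])⟩

theorem perturb_zero (F : JordanForm A d) : F.perturb 0 = A := by
  have h : F.shiftedJ 0 = F.J := by
    have : F.shift 0 = 0 := by ext i; simp [shift]
    simp [shiftedJ, this]
  ext i j
  rw [perturb, h, ← F.eq_conj]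
  simp

/-- Shifting all eigenvalues by the same amount adds a scalar matrix. -/
theorem perturb_add_const (F : JordanForm A d) (q : Fin d → ℝ) (s : ℝ) :
    F.perturb (q + fun _ => s) = F.perturb q + Matrix.scalar (Fin n) s := by
  have hdet : IsUnit F.Q.det := (Matrix.isUnit_iff_isUnit_det _).mp F.isUnit_Q
  have h : F.shiftedJ (q + fun _ => s) =
      F.shiftedJ q + algebraMap ℂ (Matrix (Fin n) (Fin n) ℂ) s := by
    rw [shiftedJ, shiftedJ, add_assoc]
    congr 1
    ext i j
    by_cases hij : i = j
    · subst hij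
      obtain ⟨k, hk⟩ := F.exists_lam_eq i
      simp [F.shift_of_eq _ i k hk, Matrix.algebraMap_matrix_apply]
    · simp [hij, Matrix.algebraMap_matrix_apply]
  ext i j
  rw [perturb, h, mul_add, add_mul, ← Algebra.commutes, mul_assoc (algebraMap ℂ _ _),
    Matrix.nonsing_inv_mul _ hdet, mul_one]
  by_cases hij : i = j <;>
    simp [hij, perturb, Matrix.algebraMap_matrix_apply, Matrix.scalar_apply]

theorem continuous_perturb (F : JordanForm A d) : Continuous F.perturb := by
  have h : ∀ i, Continuous fun q => F.shift q i := by
    intro i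
    unfold shift
    refine continuous_finsetSum _ fun k _ => ?_
    split_ifs <;> fun_prop
  have h2 : Continuous F.shiftedJ := by
    unfold shiftedJ
    refine continuous_const.add (Continuous.matrix_diagonal ?_)
    exact continuous_pi fun i => Complex.continuous_ofReal.comp (h i)
  unfold perturb
  exact ((continuous_const.matrix_mul h2).matrix_mul continuous_const).matrix_map
    Complex.continuous_re

/-- If all perturbed matrices over a closed set are controllable, then for almost every
perturbation in this set any `n` prescribed distinct powers span the whole space. -/
theorem ae_gramDet_ne_zero (F : JordanForm A d) {nu : ℕ} (B : Matrix (Fin n) (Fin nu) ℝ)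
    {S : Set (Fin d → ℝ)} (hS : IsClosed S)
    (hctrl : ∀ q ∈ S, gramDet (fun i : Fin n => F.perturb q ^ (i : ℕ) * B) ≠ 0)
    {v : Fin n → ℕ} (hv : Function.Injective v) :
    ∀ᵐ q, q ∈ S → gramDet (fun i => F.perturb q ^ v i * B) ≠ 0 := by
  set T : Set (Fin d → ℝ) := S ∩ {q | gramDet (fun i => F.perturb q ^ v i * B) = 0}
  have hcont : Continuous fun q => gramDet (fun i => F.perturb q ^ v i * B) :=
    continuous_gramDet fun i => (F.continuous_perturb.pow _).matrix_mul continuous_const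
  have hT : IsClosed T := hS.inter (isClosed_eq hcont continuous_const)
  -- The direction (1, …, 1): along it the perturbed matrix changes only by scalar matrices.
  set L : ℝ →ₗ[ℝ] (Fin d → ℝ) := LinearMap.pi fun _ => LinearMap.id
  have hL : ∀ s, L s = fun _ => s := fun s => rfl
  have key := MeasureTheory.ae_mem_of_ae_add_linearMap_mem L MeasureTheory.volume
    MeasureTheory.volume hT.measurableSet.compl ?_
  · filter_upwards [key] with q hq hqS h0
    exact hq ⟨hqS, h0⟩
  · intro y
    -- A line that meets S contains a controllable base point, from which the bad shifts are finite
    -- in number; a line that misses S has nothing to exclude.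
    by_cases hy : ∃ t : ℝ, y + L t ∈ S
    · obtain ⟨t, ht⟩ := hy
      have hfin := finite_shift_gramDet_eq_zero (hctrl _ ht) hv
      have hfin2 := hfin.preimage (f := fun x : ℝ => x - t)
        (fun a _ b _ h => by simpa using h)
      filter_upwards [MeasureTheory.compl_mem_ae_iff.mpr (hfin2.measure_zero _)] with x hx hxT
      apply hx
      have h1 : y + L x = y + L t + fun _ => (x - t) := by
        ext k; simp [hL]
      have h2 := hxT.2
      rw [Set.mem_ofPred_eq, h1, F.perturb_add_const] at h2
      exact h2
    · push Not at hy
      exact Filter.Eventually.of_forall fun x hx => hy x hx.1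

end JordanForm

/-! ### Solution formula for the linear dynamics. -/

section Dynamics

variable {n nu N : ℕ}

/-- The contribution of the controls to the final state. -/
def reach (A : Matrix (Fin n) (Fin n) ℝ) (B : Matrix (Fin n) (Fin nu) ℝ) :
    (Fin N → Fin nu → ℝ) →ₗ[ℝ] (Fin n → ℝ) :=
  ∑ j : Fin N, (Matrix.mulVecLin (A ^ (N - 1 - (j : ℕ)) * B)).comp (LinearMap.proj j)

theorem reach_apply (A : Matrix (Fin n) (Fin n) ℝ) (B : Matrix (Fin n) (Fin nu) ℝ)
    (u : Fin N → Fin nu → ℝ) :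
    reach A B u = ∑ j : Fin N, (A ^ (N - 1 - (j : ℕ)) * B).mulVec (u j) := by
  simp [reach, LinearMap.sum_apply]

theorem reach_single (A : Matrix (Fin n) (Fin n) ℝ) (B : Matrix (Fin n) (Fin nu) ℝ)
    (i : Fin N) (v : Fin nu → ℝ) :
    reach A B (Pi.single i v) = (A ^ (N - 1 - (i : ℕ)) * B).mulVec v := by
  rw [reach_apply, Finset.sum_eq_single i]
  · rw [Pi.single_eq_same]
  · intro j _ hj
    rw [Pi.single_eq_of_ne hj, Matrix.mulVec_zero]
  · simp

/-- The `k`-th state of the linear control system with initial state `x₀`. -/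
def stateAt (A : Matrix (Fin n) (Fin n) ℝ) (B : Matrix (Fin n) (Fin nu) ℝ) (x₀ : Fin n → ℝ)
    (u : Fin N → Fin nu → ℝ) (k : ℕ) : Fin n → ℝ :=
  (A ^ k).mulVec x₀ + ∑ j : Fin N, if (j : ℕ) < k then (A ^ (k - 1 - (j : ℕ)) * B).mulVec (u j)
    else 0

variable (A : Matrix (Fin n) (Fin n) ℝ) (B : Matrix (Fin n) (Fin nu) ℝ) (x₀ : Fin n → ℝ)
  (u : Fin N → Fin nu → ℝ)

theorem stateAt_zero : stateAt A B x₀ u 0 = x₀ := by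
  simp [stateAt]

theorem stateAt_succ (i : Fin N) :
    stateAt A B x₀ u ((i : ℕ) + 1) = A.mulVec (stateAt A B x₀ u i) + B.mulVec (u i) := by
  have h : ∀ j : Fin N, (if (j : ℕ) < (i : ℕ) + 1 then
      (A ^ ((i : ℕ) + 1 - 1 - (j : ℕ)) * B).mulVec (u j) else 0) =
      A.mulVec (if (j : ℕ) < i then (A ^ ((i : ℕ) - 1 - (j : ℕ)) * B).mulVec (u j) else 0) +
        if j = i then B.mulVec (u i) else 0 := by
    intro j
    rcases lt_trichotomy (j : ℕ) i with hji | hji | hji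
    · rw [if_pos (by omega), if_pos hji, if_neg (by intro h; subst h; omega), add_zero,
        Matrix.mulVec_mulVec, ← Matrix.mul_assoc, ← pow_succ',
        show (i : ℕ) - 1 - (j : ℕ) + 1 = (i : ℕ) + 1 - 1 - (j : ℕ) by omega]
    · obtain rfl : j = i := Fin.ext hji
      simp
    · rw [if_neg (by omega), if_neg (by omega), if_neg (by intro h; subst h; omega)]
      simp
  unfold stateAt
  simp_rw [h]
  rw [Finset.sum_add_distrib, Finset.sum_ite_eq' Finset.univ i, if_pos (Finset.mem_univ i),
    Matrix.mulVec_add, Matrix.mulVec_mulVec, pow_succ', Matrix.mulVec_sum, add_assoc]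

theorem stateAt_final : stateAt A B x₀ u N = (A ^ N).mulVec x₀ + reach A B u := by
  rw [stateAt, reach_apply]
  congr 1
  exact Finset.sum_congr rfl fun j _ => if_pos j.2

variable {A B x₀ u}

theorem eq_stateAt {x : Fin (N + 1) → Fin n → ℝ} (h0 : x 0 = x₀)
    (hs : ∀ i : Fin N, x i.succ = A.mulVec (x i.castSucc) + B.mulVec (u i)) (k : Fin (N + 1)) :
    x k = stateAt A B x₀ u k := by
  induction k using Fin.induction with
  | zero => rw [h0, Fin.val_zero, stateAt_zero]
  | succ i ih => rw [hs, ih, Fin.val_succ, stateAt_succ, Fin.val_castSucc]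

end Dynamics

theorem continuous_toMatrix' {X : Type*} [TopologicalSpace X] {k l : ℕ}
    {T : X → (Fin k → ℝ) →ₗ[ℝ] (Fin l → ℝ)} (hT : ∀ v, Continuous fun x => T x v) :
    Continuous fun x => LinearMap.toMatrix' (T x) := by
  refine continuous_matrix fun i j => ?_
  simp only [LinearMap.toMatrix'_apply]
  exact (continuous_apply i).comp (hT _)

/-! ### Elimination of the states, and stability under changes of the dynamics. -/

namespace RelaxedProblem

variable {n nu nG N : ℕ}

/-- The final state as a function of the controls. -/
def terminal (P : RelaxedProblem n nu nG N) (u : Fin N → Fin nu → ℝ) : Fin n → ℝ :=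
  (P.A ^ N).mulVec P.xInit + reach P.A P.B u

theorem terminal_sub (P : RelaxedProblem n nu nG N) (u v : Fin N → Fin nu → ℝ) :
    P.terminal u - P.terminal v = reach P.A P.B (u - v) := by
  rw [terminal, terminal, map_sub]; abel

theorem continuous_reach {X : Type*} [TopologicalSpace X] {A : X → Matrix (Fin n) (Fin n) ℝ}
    {u : X → Fin N → Fin nu → ℝ} (B : Matrix (Fin n) (Fin nu) ℝ) (hA : Continuous A)
    (hu : Continuous u) : Continuous fun x => reach (A x) B (u x) := by
  simp_rw [reach_apply]
  refine continuous_finsetSum _ fun j _ => ?_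
  exact ((hA.pow _).matrix_mul continuous_const).matrix_mulVec ((continuous_apply j).comp hu)

theorem continuous_terminal_withDynamics (P : RelaxedProblem n nu nG N) :
    Continuous fun p : Matrix (Fin n) (Fin n) ℝ × (Fin N → Fin nu → ℝ) =>
      (P.withDynamics p.1).terminal p.2 :=
  ((continuous_fst.pow N).matrix_mulVec continuous_const).add (continuous_reach P.B continuous_fst continuous_snd)

theorem continuous_terminal (P : RelaxedProblem n nu nG N) : Continuous P.terminal :=
  P.continuous_terminal_withDynamics.comp (Continuous.prodMk_right P.A)

/-- The trajectory generated by the controls `u`, with slacks `σ`. -/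
def trajOf (P : RelaxedProblem n nu nG N) (u : Fin N → Fin nu → ℝ) (σ : Fin N → ℝ) :
    Traj n nu N :=
  (fun k => stateAt P.A P.B P.xInit u k, u, σ)

theorem trajOf_last (P : RelaxedProblem n nu nG N) (u : Fin N → Fin nu → ℝ) (σ : Fin N → ℝ) :
    (P.trajOf u σ).1 (Fin.last N) = P.terminal u := by
  show stateAt P.A P.B P.xInit u (Fin.last N : ℕ) = _
  rw [Fin.val_last, stateAt_final, terminal]

theorem H_trajOf_eq_zero {P : RelaxedProblem n nu nG N} {u : Fin N → Fin nu → ℝ}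
    {σ : Fin N → ℝ} (hG : P.G (P.terminal u) = 0) : P.H (P.trajOf u σ) = 0 := by
  unfold H
  rw [P.trajOf_last, hG]
  refine Prod.ext ?_ (Prod.ext ?_ rfl)
  · funext i
    show P.A.mulVec (stateAt P.A P.B P.xInit u i.castSucc) + P.B.mulVec (u i) -
      stateAt P.A P.B P.xInit u i.succ = 0
    rw [Fin.val_succ, stateAt_succ, Fin.val_castSucc, sub_self]
  · show stateAt P.A P.B P.xInit u (0 : Fin (N + 1)) - P.xInit = 0
    rw [Fin.val_zero, stateAt_zero, sub_self]

theorem feasible_trajOf {P : RelaxedProblem n nu nG N} {u : Fin N → Fin nu → ℝ}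
    {σ : Fin N → ℝ} (hG : P.G (P.terminal u) = 0) (hV : ∀ i, (u i, σ i) ∈ P.V) :
    P.Feasible (P.trajOf u σ) :=
  ⟨H_trajOf_eq_zero hG, hV⟩

theorem last_eq_terminal {P : RelaxedProblem n nu nG N} {z : Traj n nu N} (h : P.H z = 0) :
    z.1 (Fin.last N) = P.terminal z.2.1 := by
  have h1 := congrArg Prod.fst h
  have h2 := congrArg (fun w => w.2.1) h
  have h3 := eq_stateAt (A := P.A) (B := P.B) (x₀ := P.xInit) (u := z.2.1) (x := z.1)
    (sub_eq_zero.mp h2) (fun i => (sub_eq_zero.mp (congrFun h1 i)).symm) (Fin.last N)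
  rw [h3, Fin.val_last, stateAt_final, terminal]

theorem G_terminal_eq_zero {P : RelaxedProblem n nu nG N} {z : Traj n nu N} (h : P.H z = 0) :
    P.G (P.terminal z.2.1) = 0 := by
  rw [← last_eq_terminal h]
  exact congrArg (fun w => w.2.2) h

/-- The linear part of the constraint map `H`. -/
def linearH (P : RelaxedProblem n nu nG N) :
    Traj n nu N →ₗ[ℝ] (Fin N → Fin n → ℝ) × (Fin n → ℝ) × (Fin nG → ℝ) where
  toFun z := (fun i => P.A.mulVec (z.1 i.castSucc) + P.B.mulVec (z.2.1 i) - z.1 i.succ,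
    z.1 0, P.G.linear (z.1 (Fin.last N)))
  map_add' z w := by
    refine Prod.ext ?_ (Prod.ext rfl (map_add _ _ _))
    funext i
    simp only [Prod.fst_add, Prod.snd_add, Pi.add_apply, Matrix.mulVec_add]
    abel
  map_smul' c z := by
    refine Prod.ext ?_ (Prod.ext rfl (P.G.linear.map_smul c _))
    funext i
    simp only [Prod.smul_fst, Prod.smul_snd, Pi.smul_apply, Matrix.mulVec_smul, smul_add, smul_sub,
      RingHom.id_apply]

theorem H_eq_linearH_add (P : RelaxedProblem n nu nG N) (z : Traj n nu N) :
    P.H z = P.linearH z + (0, -P.xInit, P.G 0) := by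
  refine Prod.ext ?_ (Prod.ext ?_ ?_)
  · simp [H, linearH]
  · simp [H, linearH, sub_eq_add_neg]
  · simp only [H, linearH, LinearMap.coe_mk, AddHom.coe_mk, Prod.snd_add]
    exact congrFun P.G.decomp _

/-- Solve the linearized constraints with right-hand side (0, 0, w): the dynamics are then exact and
start at 0, so the final state comes from the controls alone. -/
theorem FullRowRank.surjective {P : RelaxedProblem n nu nG N} (h : P.FullRowRank) :
    Function.Surjective (P.G.linear.comp (reach (N := N) P.A P.B)) := by
  intro w
  have hd : HasFDerivAt P.H (LinearMap.toContinuousLinearMap P.linearH) 0 := by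
    have h1 : P.H = fun z => LinearMap.toContinuousLinearMap P.linearH z +
        ((0, -P.xInit, P.G 0) : (Fin N → Fin n → ℝ) × (Fin n → ℝ) × (Fin nG → ℝ)) :=
      funext P.H_eq_linearH_add
    rw [h1]
    exact (ContinuousLinearMap.hasFDerivAt _).add_const _
  have h0 := h 0
  rw [hd.fderiv] at h0
  obtain ⟨z, hz⟩ := h0 (0, 0, w)
  refine ⟨z.2.1, ?_⟩
  have h1 := congrArg Prod.fst hz
  have h2 := congrArg (fun w => w.2.1) hz
  have h3 := eq_stateAt (A := P.A) (B := P.B) (x₀ := 0) (u := z.2.1) (x := z.1)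
    h2 (fun i => (sub_eq_zero.mp (congrFun h1 i)).symm) (Fin.last N)
  rw [Fin.val_last, stateAt_final, Matrix.mulVec_zero, zero_add] at h3
  rw [LinearMap.comp_apply, ← h3]
  exact congrArg (fun w => w.2.2) hz

/-- A strictly feasible control, together with surjectivity of the terminal constraint. -/
def ControlSlater (P : RelaxedProblem n nu nG N) : Prop :=
  (∃ (u : Fin N → Fin nu → ℝ) (σ : Fin N → ℝ), (∀ᶠ u' in nhds u, ∀ i, (u' i, σ i) ∈ P.V) ∧ P.G (P.terminal u) = 0) ∧
    Function.Surjective (P.G.linear.comp (reach (N := N) P.A P.B))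

theorem G_continuous (P : RelaxedProblem n nu nG N) : Continuous P.G :=
  P.G.continuous_of_finiteDimensional

/-- The terminal residual created by changing the matrix is cancelled by a small control correction
in the range of a fixed right inverse R. A small correction keeps the controls strictly feasible. -/
theorem eventually_controlSlater {P : RelaxedProblem n nu nG N} (hrank : P.FullRowRank)
    (hslater : P.Slater) : ∀ᶠ A' in nhds P.A, (P.withDynamics A').ControlSlater := by
  obtain ⟨z, hz, hHz⟩ := hslater
  set u := z.2.1
  have hV : ∀ᶠ u' in nhds u, ∀ i, (u' i, z.2.2 i) ∈ P.V := by
    have hc : Continuous fun u' : Fin N → Fin nu → ℝ => ((z.1, u', z.2.2) : Traj n nu N) := by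
      fun_prop
    exact hc.continuousAt.eventually (p := fun z' => z' ∈ P.VTilde)
      (mem_interior_iff_mem_nhds.mp hz)
  have hGu : P.G (P.terminal u) = 0 := G_terminal_eq_zero hHz
  obtain ⟨R, hR⟩ := LinearMap.exists_rightInverse_of_surjective _
    (LinearMap.range_eq_top.mpr hrank.surjective)
  set T : Matrix (Fin n) (Fin n) ℝ → (Fin nG → ℝ) →ₗ[ℝ] (Fin nG → ℝ) := fun A' =>
    (P.G.linear.comp (reach A' P.B)).comp R with hT
  have hTc : ∀ v, Continuous fun A' => T A' v := by
    intro v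
    have h1 : Continuous fun A' => reach A' P.B (R v) :=
      continuous_reach P.B continuous_id continuous_const
    exact P.G.linear.continuous_of_finiteDimensional.comp h1
  set M := fun A' => LinearMap.toMatrix' (T A') with hM
  have hMc : Continuous M := continuous_toMatrix' hTc
  have hMv : ∀ A' w, (M A').mulVec w = P.G.linear (reach A' P.B (R w)) := by
    intro A' w
    rw [hM, ← Matrix.toLin'_apply, Matrix.toLin'_toMatrix', hT]
    rfl
  clear_value M
  have hMA : M P.A = 1 := by
    apply Matrix.mulVec_injective
    funext y
    rw [hMv, Matrix.one_mulVec]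
    exact LinearMap.congr_fun hR y
  -- This is -(M A')⁻¹ applied to the residual, with the inverse written through the adjugate so
  -- that continuity at `P.A` is immediate.
  set w : Matrix (Fin n) (Fin n) ℝ → Fin nG → ℝ := fun A' =>
    -((M A').det⁻¹ • (M A').adjugate.mulVec (P.G ((P.withDynamics A').terminal u))) with hw
  have hdet : ∀ᶠ A' in nhds P.A, (M A').det ≠ 0 := by
    refine hMc.matrix_det.continuousAt.eventually_ne ?_
    rw [hMA, Matrix.det_one]; exact one_ne_zero
  have hwc : ContinuousAt w P.A := by
    refine ((hMc.matrix_det.continuousAt.inv₀ hdet.self_of_nhds).smul ?_).neg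
    refine (hMc.matrix_adjugate.matrix_mulVec (P.G_continuous.comp ?_)).continuousAt
    exact P.continuous_terminal_withDynamics.comp (Continuous.prodMk_left u)
  have hwA : w P.A = 0 := by
    have : P.G ((P.withDynamics P.A).terminal u) = 0 := hGu
    simp [hw, this]
  have huc : ContinuousAt (fun A' => u + R (w A')) P.A :=
    continuousAt_const.add (R.continuous_of_finiteDimensional.continuousAt.comp hwc)
  have hV' : ∀ᶠ A' in nhds P.A, ∀ᶠ u' in nhds (u + R (w A')), ∀ i, (u' i, z.2.2 i) ∈ P.V := by
    have h1 := hV.eventually_nhds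
    refine huc.eventually (p := fun v => ∀ᶠ u' in nhds v, ∀ i, (u' i, z.2.2 i) ∈ P.V) ?_
    dsimp only
    rw [hwA, map_zero, add_zero]
    exact h1
  filter_upwards [hdet, hV'] with A' hA' hVA'
  refine ⟨⟨u + R (w A'), z.2.2, hVA', ?_⟩, ?_⟩
  · have h1 : (P.withDynamics A').terminal (u + R (w A')) =
        reach A' P.B (R (w A')) +ᵥ (P.withDynamics A').terminal u := by
      rw [vadd_eq_add]
      have := (P.withDynamics A').terminal_sub (u + R (w A')) u
      rw [add_sub_cancel_left] at this
      exact sub_eq_iff_eq_add.mp this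
    rw [h1]
    show P.G _ = 0
    rw [AffineMap.map_vadd, ← hMv, hw]
    dsimp only
    rw [Matrix.mulVec_neg, Matrix.mulVec_smul, Matrix.mulVec_mulVec, Matrix.mul_adjugate,
      Matrix.smul_mulVec, Matrix.one_mulVec, smul_smul, inv_mul_cancel₀ hA', one_smul,
      vadd_eq_add, neg_add_cancel]
  · intro y
    refine ⟨R ((M A')⁻¹.mulVec y), ?_⟩
    have h2 := hMv A' ((M A')⁻¹.mulVec y)
    rw [Matrix.mulVec_mulVec, Matrix.mul_nonsing_inv _ (isUnit_iff_ne_zero.mpr hA'),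
      Matrix.one_mulVec] at h2
    exact h2.symm

theorem IsConvex.continuous_g {P : RelaxedProblem n nu nG N} (h : P.IsConvex) :
    Continuous P.g :=
  h.2.1.locallyLipschitz.continuous

theorem IsConvex.isClosed_V {P : RelaxedProblem n nu nG N} (h : P.IsConvex) : IsClosed P.V :=
  (isClosed_le continuous_const continuous_snd).inter
    ((isClosed_le continuous_snd continuous_const).inter
      (isClosed_le (h.continuous_g.comp continuous_fst) continuous_snd))

/-- States are determined by controls, so a continuous cost is minimized over a compact set of pairs
(u, σ). -/
theorem exists_isOptimal {P : RelaxedProblem n nu nG N} (hconv : P.IsConvex)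
    (hreg : P.RegularCompact) (hslater : P.ControlSlater) : ∃ z, P.IsOptimal z := by
  set K : Set ((Fin N → Fin nu → ℝ) × (Fin N → ℝ)) :=
    {w | (∀ i, (w.1 i, w.2 i) ∈ P.V) ∧ P.G (P.terminal w.1) = 0} with hK
  have hKclosed : IsClosed K := by
    have h1 : IsClosed {w : (Fin N → Fin nu → ℝ) × (Fin N → ℝ) | ∀ i, (w.1 i, w.2 i) ∈ P.V} := by
      rw [Set.ofPred_forall]
      exact isClosed_iInter fun i => hconv.isClosed_V.preimage (by fun_prop)
    exact h1.inter (isClosed_eq (P.G_continuous.comp (P.continuous_terminal.comp continuous_fst))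
      continuous_const)
  have hKcompact : IsCompact K := by
    refine (hreg.2.2.2.2.prod (isCompact_Icc (a := fun _ : Fin N => P.rhoMin)
      (b := fun _ => P.rhoMax))).of_isClosed_subset hKclosed ?_
    rintro ⟨u, σ⟩ ⟨hw, -⟩
    exact ⟨fun i => (hw i).2.2.trans (hw i).2.1, fun i => (hw i).1, fun i => (hw i).2.1⟩
  obtain ⟨⟨u₀, σ₀, hV, hG⟩, -⟩ := hslater
  have hcont : ContinuousOn (fun w : (Fin N → Fin nu → ℝ) × (Fin N → ℝ) =>
      P.m (P.terminal w.1) + ∑ i, P.l i (w.2 i)) K := by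
    refine ContinuousOn.add ?_ (continuousOn_finsetSum _ fun i _ => ?_)
    · exact (hreg.2.2.1.continuous.comp (P.continuous_terminal.comp continuous_fst)).continuousOn
    · refine (hreg.1 i).continuousOn.comp (by fun_prop) ?_
      intro w hw
      exact (hw.1 i).1
  obtain ⟨⟨u, σ⟩, hw, hmin⟩ := hKcompact.exists_isMinOn
    ⟨(u₀, σ₀), hV.self_of_nhds, hG⟩ hcont
  refine ⟨P.trajOf u σ, feasible_trajOf hw.2 hw.1, fun z hz => ?_⟩
  have := hmin (show (z.2.1, z.2.2) ∈ K from ⟨hz.2, G_terminal_eq_zero hz.1⟩)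
  unfold objective
  rw [P.trajOf_last, last_eq_terminal hz.1]
  exact this

/-- Problems with a control for which all slacks can be `ρ_min` and the final state minimizes the
terminal cost. -/
def Abnormal (P : RelaxedProblem n nu nG N) : Prop :=
  ∃ u : Fin N → Fin nu → ℝ, (∀ i, P.g (u i) ≤ P.rhoMin) ∧ P.SolvesTerminal (P.terminal u)

/-- With all slacks at ρ_min, such a control minimizes both parts of the objective at once, giving
an optimal solution that normality forbids. -/
theorem Normal.not_abnormal {P : RelaxedProblem n nu nG N} (hnormal : P.Normal)
    (hreg : P.RegularCompact) (hle : N ≠ 0 → P.rhoMin ≤ P.rhoMax) : ¬ P.Abnormal := by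
  rintro ⟨u, hu, hT⟩
  have hN : ∀ _ : Fin N, P.rhoMin ≤ P.rhoMax := fun i => hle (by have := i.2; omega)
  have hopt : P.IsOptimal (P.trajOf u fun _ => P.rhoMin) := by
    refine ⟨feasible_trajOf hT.1 fun i => ⟨le_rfl, hN i, hu i⟩, fun z hz => ?_⟩
    unfold objective
    rw [P.trajOf_last, last_eq_terminal hz.1]
    refine add_le_add (hT.2 _ (G_terminal_eq_zero hz.1)) (Finset.sum_le_sum fun i _ => ?_)
    exact (hreg.2.1 i).monotoneOn (Set.self_mem_Ici) (hz.2 i).1 (hz.2 i).1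
  rcases hnormal _ hopt with ⟨i, hi⟩ | h
  · exact lt_irrefl _ hi
  · rw [P.trajOf_last] at h
    exact h hT

/-- The pairs (A', u) that witness abnormality form a closed set with u in a compact set, so their
projection to A' is closed. -/
theorem eventually_not_abnormal {P : RelaxedProblem n nu nG N} (hconv : P.IsConvex)
    (hreg : P.RegularCompact) (hle : N ≠ 0 → P.rhoMin ≤ P.rhoMax) (hP : ¬ P.Abnormal) :
    ∀ᶠ A' in nhds P.A, ¬ (P.withDynamics A').Abnormal := by
  set C : Set (Fin N → Fin nu → ℝ) := {u | ∀ i, P.g (u i) ≤ P.rhoMin} with hC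
  have hCc : IsCompact C := by
    refine hreg.2.2.2.2.of_isClosed_subset ?_ ?_
    · rw [hC, Set.ofPred_forall]
      exact isClosed_iInter fun i => isClosed_le (hconv.continuous_g.comp (continuous_apply i))
        continuous_const
    · exact fun u hu i => (hu i).trans (hle (by have := i.2; omega))
  have hS : IsClosed {y | P.SolvesTerminal y} := by
    refine (isClosed_eq P.G_continuous continuous_const).inter ?_
    change IsClosed {y | ∀ y', P.G y' = 0 → P.m y ≤ P.m y'}
    rw [show {y | ∀ y', P.G y' = 0 → P.m y ≤ P.m y'} =
      ⋂ y', ⋂ _ : P.G y' = 0, {y | P.m y ≤ P.m y'} by ext y; simp]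
    exact isClosed_iInter fun y' => isClosed_iInter fun _ =>
      isClosed_le hreg.2.2.1.continuous continuous_const
  have := isCompact_iff_compactSpace.mp hCc
  have hZ : IsClosed {p : Matrix (Fin n) (Fin n) ℝ × C |
      P.SolvesTerminal ((P.withDynamics p.1).terminal p.2)} :=
    hS.preimage (P.continuous_terminal_withDynamics.comp
      (continuous_fst.prodMk (continuous_subtype_val.comp continuous_snd)))
  have hclosed := isClosedMap_fst_of_compactSpace _ hZ
  have hA : P.A ∈ (Prod.fst '' {p : Matrix (Fin n) (Fin n) ℝ × C |
      P.SolvesTerminal ((P.withDynamics p.1).terminal p.2)})ᶜ := by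
    rintro ⟨⟨A', u⟩, hu, rfl⟩
    exact hP ⟨u, u.2, hu⟩
  filter_upwards [hclosed.isOpen_compl.mem_nhds hA] with A' hA'
  rintro ⟨u, hu, hT⟩
  exact hA' ⟨(A', ⟨u, hu⟩), hT, rfl⟩

end RelaxedProblem

/-! ### Tangents of convex functions. -/

section Convex

variable {E : Type*} [NormedAddCommGroup E] [NormedSpace ℝ E]

theorem HasFDerivAt.tendsto_lineSlope {f : E → ℝ} {x : E} {f' : E →L[ℝ] ℝ}
    (hf : HasFDerivAt f f' x) (v : E) :
    Filter.Tendsto (fun t : ℝ => t⁻¹ * (f (x + t • v) - f x)) (nhdsWithin 0 (Set.Ioi 0))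
      (nhds (f' v)) := by
  have h := (hf.hasLineDerivAt v).tendsto_slope_zero_right
  simpa [HasLineDerivAt] using h

/-- The tangent inequality for convex functions. -/
theorem ConvexOn.fderiv_le_sub {f : E → ℝ} (hconv : ConvexOn ℝ Set.univ f) {x : E}
    {f' : E →L[ℝ] ℝ} (hf : HasFDerivAt f f' x) (y : E) : f' (y - x) ≤ f y - f x := by
  refine le_of_tendsto (hf.tendsto_lineSlope (y - x)) ?_
  filter_upwards [Ioo_mem_nhdsGT (zero_lt_one (α := ℝ))] with t ht
  have h := hconv.2 (Set.mem_univ x) (Set.mem_univ y) (sub_nonneg.mpr ht.2.le) ht.1.le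
    (sub_add_cancel 1 t)
  have e : (1 - t) • x + t • y = x + t • (y - x) := by
    rw [sub_smul, one_smul, smul_sub]; abel
  rw [e, smul_eq_mul, smul_eq_mul] at h
  rw [inv_mul_le_iff₀ ht.1]
  linarith

end Convex

/-! ### Multipliers and the maximum principle. -/

namespace RelaxedProblem

variable {n nu nG N : ℕ}

theorem IsConvex.convex_V {P : RelaxedProblem n nu nG N} (h : P.IsConvex) : Convex ℝ P.V := by
  rintro ⟨u, s⟩ ⟨h1, h2, h3⟩ ⟨v, t⟩ ⟨h4, h5, h6⟩ a b ha hb hab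
  refine ⟨?_, ?_, ?_⟩
  · exact (convex_Ici P.rhoMin) h1 h4 ha hb hab
  · exact (convex_Iic P.rhoMax) h2 h5 ha hb hab
  · refine (h.2.1.2 (Set.mem_univ u) (Set.mem_univ v) ha hb hab).trans ?_
    exact add_le_add (smul_le_smul_of_nonneg_left h3 ha) (smul_le_smul_of_nonneg_left h6 hb)

theorem terminal_combo (P : RelaxedProblem n nu nG N) (u v : Fin N → Fin nu → ℝ) {a b : ℝ}
    (hab : a + b = 1) : P.terminal (a • u + b • v) = a • P.terminal u + b • P.terminal v := by
  have h : (P.A ^ N).mulVec P.xInit = (a + b) • (P.A ^ N).mulVec P.xInit := by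
    rw [hab, one_smul]
  simp only [terminal, map_add, map_smul, smul_add]
  nth_rewrite 1 [h]
  rw [add_smul]
  abel

/-- The running cost. -/
def slackCost (P : RelaxedProblem n nu nG N) (σ : Fin N → ℝ) : ℝ := ∑ i, P.l i (σ i)

theorem IsConvex.slackCost_combo {P : RelaxedProblem n nu nG N} (h : P.IsConvex)
    {σ τ : Fin N → ℝ} (hσ : ∀ i, P.rhoMin ≤ σ i) (hτ : ∀ i, P.rhoMin ≤ τ i) {a b : ℝ}
    (ha : 0 ≤ a) (hb : 0 ≤ b) (hab : a + b = 1) :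
    P.slackCost (a • σ + b • τ) ≤ a * P.slackCost σ + b * P.slackCost τ := by
  unfold slackCost
  rw [Finset.mul_sum, Finset.mul_sum, ← Finset.sum_add_distrib]
  exact Finset.sum_le_sum fun i _ => (h.2.2 i).2 (hσ i) (hτ i) ha hb hab

/-- Optimality for the problem with the terminal cost linearized at an optimal final state. -/
theorem IsOptimal.linearized {P : RelaxedProblem n nu nG N} (hconv : P.IsConvex)
    {z : Traj n nu N} (hz : P.IsOptimal z) {c : (Fin n → ℝ) →L[ℝ] ℝ}
    (hc : HasFDerivAt P.m c (P.terminal z.2.1)) {u : Fin N → Fin nu → ℝ} {σ : Fin N → ℝ}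
    (hV : ∀ i, (u i, σ i) ∈ P.V) (hG : P.G (P.terminal u) = 0) :
    0 ≤ c (P.terminal u - P.terminal z.2.1) + (P.slackCost σ - P.slackCost z.2.2) := by
  -- Move a fraction t towards the competitor, bound the slack cost by convexity, divide by t and
  -- let t tend to 0.
  have hlim := (hc.tendsto_lineSlope (P.terminal u - P.terminal z.2.1)).add_const
    (P.slackCost σ - P.slackCost z.2.2)
  refine ge_of_tendsto hlim ?_
  filter_upwards [Ioo_mem_nhdsGT (zero_lt_one (α := ℝ))] with t ht
  have ht1 : 0 ≤ 1 - t := sub_nonneg.mpr ht.2.le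
  have hab := sub_add_cancel 1 t
  have hG0 := G_terminal_eq_zero hz.1.1
  have hterm := P.terminal_combo z.2.1 u hab
  have hfeas : P.Feasible (P.trajOf ((1 - t) • z.2.1 + t • u) ((1 - t) • z.2.2 + t • σ)) := by
    refine feasible_trajOf ?_ fun i => hconv.convex_V (hz.1.2 i) (hV i) ht1 ht.1.le hab
    rw [hterm, Convex.combo_affine_apply hab, hG0, hG, smul_zero, smul_zero, add_zero]
  have hle := hz.2 _ hfeas
  have hL := hconv.slackCost_combo (fun i => (hz.1.2 i).1) (fun i => (hV i).1) ht1 ht.1.le hab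
  unfold objective at hle
  rw [P.trajOf_last, last_eq_terminal hz.1.1, hterm] at hle
  change P.m _ + P.slackCost z.2.2 ≤ P.m _ + P.slackCost ((1 - t) • z.2.2 + t • σ) at hle
  have e : (1 - t) • P.terminal z.2.1 + t • P.terminal u =
      P.terminal z.2.1 + t • (P.terminal u - P.terminal z.2.1) := by
    rw [sub_smul, one_smul, smul_sub]; abel
  rw [e] at hle
  rw [← mul_le_mul_iff_right₀ ht.1, mul_zero, mul_add, mul_inv_cancel_left₀ ht.1.ne']
  linarith

/-- Perturbation values of the linearized problem: achievable (strict upper bounds for the) cost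
differences together with the residual of the terminal constraint. -/
def valueSet (P : RelaxedProblem n nu nG N) (z : Traj n nu N) (c : (Fin n → ℝ) →L[ℝ] ℝ) :
    Set (ℝ × (Fin nG → ℝ)) :=
  {p | ∃ (u : Fin N → Fin nu → ℝ) (σ : Fin N → ℝ), (∀ i, (u i, σ i) ∈ P.V) ∧
    P.G (P.terminal u) = p.2 ∧
    c (P.terminal u - P.terminal z.2.1) + (P.slackCost σ - P.slackCost z.2.2) < p.1}

theorem convex_valueSet {P : RelaxedProblem n nu nG N} (hconv : P.IsConvex) (z : Traj n nu N)
    (c : (Fin n → ℝ) →L[ℝ] ℝ) : Convex ℝ (P.valueSet z c) := by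
  rintro ⟨r, w⟩ ⟨u, σ, h1, rfl, h3⟩ ⟨r', w'⟩ ⟨v, τ, h4, rfl, h6⟩ a b ha hb hab
  refine ⟨a • u + b • v, a • σ + b • τ, fun i => hconv.convex_V (h1 i) (h4 i) ha hb hab, ?_, ?_⟩
  · rw [P.terminal_combo _ _ hab, Convex.combo_affine_apply hab]
    rfl
  · have hL := hconv.slackCost_combo (fun i => (h1 i).1) (fun i => (h4 i).1) ha hb hab
    have e : a • P.terminal u + b • P.terminal v - P.terminal z.2.1 =
        a • (P.terminal u - P.terminal z.2.1) + b • (P.terminal v - P.terminal z.2.1) := by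
      have : P.terminal z.2.1 = (a + b) • P.terminal z.2.1 := by rw [hab, one_smul]
      nth_rewrite 1 [this]
      rw [add_smul, smul_sub, smul_sub]; abel
    rw [P.terminal_combo _ _ hab, e, map_add, map_smul, map_smul]
    simp only [smul_eq_mul, Prod.fst_add, Prod.smul_fst] at *
    have hz : P.slackCost z.2.2 = a * P.slackCost z.2.2 + b * P.slackCost z.2.2 := by
      rw [← add_mul, hab, one_mul]
    -- A strict inequality survives only a positive weight; if a = 0, the strictness comes from the
    -- second point.
    rcases ha.eq_or_lt with rfl | ha'
    · have hb1 : b = 1 := by linarith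
      subst hb1
      linarith
    · have h7 := mul_lt_mul_of_pos_left h3 ha'
      have h8 := mul_le_mul_of_nonneg_left h6.le hb
      linarith

/-- Controls u + R w reach every small residual w at a cost near f 0. The positivity of r later
fixes the sign of the cost coefficient of the separating functional. -/
theorem exists_mem_interior_valueSet {P : RelaxedProblem n nu nG N} (hslater : P.ControlSlater)
    (z : Traj n nu N) (c : (Fin n → ℝ) →L[ℝ] ℝ) :
    ∃ r : ℝ, 0 < r ∧ (r, 0) ∈ interior (P.valueSet z c) := by
  obtain ⟨⟨u, σ, hV, hG⟩, hsurj⟩ := hslater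
  obtain ⟨R, hR⟩ := LinearMap.exists_rightInverse_of_surjective _
    (LinearMap.range_eq_top.mpr hsurj)
  set f : (Fin nG → ℝ) → ℝ := fun w => c (P.terminal (u + R w) - P.terminal z.2.1) +
    (P.slackCost σ - P.slackCost z.2.2) with hf
  have hRc : Continuous fun w => u + R w :=
    continuous_const.add (LinearMap.continuous_of_finiteDimensional R)
  have hfc : Continuous f := (c.continuous.comp
    ((P.continuous_terminal.comp hRc).sub continuous_const)).add continuous_const
  refine ⟨max (f 0) 0 + 1, by positivity, mem_interior_iff_mem_nhds.mpr ?_⟩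
  have h1 : ∀ᶠ p : ℝ × (Fin nG → ℝ) in nhds (max (f 0) 0 + 1, 0), f p.2 < p.1 := by
    refine (hfc.comp continuous_snd).continuousAt.eventually_lt continuous_fst.continuousAt ?_
    exact lt_of_le_of_lt (le_max_left _ _) (lt_add_one _)
  have h2 : ∀ᶠ p : ℝ × (Fin nG → ℝ) in nhds (max (f 0) 0 + 1, 0),
      ∀ i, ((u + R p.2) i, σ i) ∈ P.V := by
    have h3 : Continuous fun p : ℝ × (Fin nG → ℝ) => u + R p.2 := hRc.comp continuous_snd
    refine h3.continuousAt.eventually (p := fun v => ∀ i, (v i, σ i) ∈ P.V) ?_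
    simpa using hV
  filter_upwards [h1, h2] with p hp1 hp2
  refine ⟨u + R p.2, σ, hp2, ?_, hp1⟩
  have h3 : P.terminal (u + R p.2) = reach P.A P.B (R p.2) +ᵥ P.terminal u := by
    rw [vadd_eq_add]
    have := P.terminal_sub (u + R p.2) u
    rw [add_sub_cancel_left] at this
    exact sub_eq_iff_eq_add.mp this
  rw [h3, AffineMap.map_vadd, hG, vadd_eq_add, add_zero]
  exact LinearMap.congr_fun hR p.2

/-- A Lagrange multiplier for the terminal constraint of the linearized problem. -/
theorem IsOptimal.exists_multiplier {P : RelaxedProblem n nu nG N} (hconv : P.IsConvex)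
    (hslater : P.ControlSlater) {z : Traj n nu N} (hz : P.IsOptimal z)
    {c : (Fin n → ℝ) →L[ℝ] ℝ} (hc : HasFDerivAt P.m c (P.terminal z.2.1)) :
    ∃ ν : (Fin nG → ℝ) →L[ℝ] ℝ, ∀ (u : Fin N → Fin nu → ℝ) (σ : Fin N → ℝ),
      (∀ i, (u i, σ i) ∈ P.V) →
      0 ≤ c (P.terminal u - P.terminal z.2.1) + ν (P.G (P.terminal u)) +
        (P.slackCost σ - P.slackCost z.2.2) := by
  obtain ⟨r, hr, hint⟩ := exists_mem_interior_valueSet hslater z c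
  have hcv := convex_valueSet hconv z c
  have h0 : (0 : ℝ × (Fin nG → ℝ)) ∉ interior (P.valueSet z c) := by
    intro h
    obtain ⟨u, σ, h1, h2, h3⟩ := interior_subset h
    exact absurd (hz.linearized hconv hc h1 h2) (not_le.mpr h3)
  obtain ⟨f, hf⟩ := geometric_hahn_banach_open_point hcv.interior isOpen_interior h0
  rw [map_zero] at hf
  -- A convex set with nonempty interior lies in the closure of that interior.
  have hf' : ∀ p ∈ P.valueSet z c, f p ≤ 0 := by
    intro p hp
    have h1 : closure (interior (P.valueSet z c)) ⊆ f ⁻¹' Set.Iic 0 :=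
      closure_minimal (fun x hx => (hf x hx).le) (isClosed_Iic.preimage f.continuous)
    rw [hcv.closure_interior_eq_closure_of_nonempty_interior ⟨_, hint⟩] at h1
    exact h1 (subset_closure hp)
  set α := f (1, 0) with hα
  have hdec : ∀ (s : ℝ) w, f (s, w) = s * α + f (0, w) := by
    intro s w
    have : ((s, w) : ℝ × (Fin nG → ℝ)) = s • (1, 0) + (0, w) := by simp
    rw [this, map_add, map_smul, smul_eq_mul]
  -- Slater's condition rules out a degenerate multiplier, so division by α is possible.
  have hα0 : α < 0 := by
    have h1 := hf _ hint
    rw [hdec, show ((0, 0) : ℝ × (Fin nG → ℝ)) = 0 from rfl, map_zero, add_zero] at h1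
    exact by
      by_contra h
      exact absurd h1 (not_lt.mpr (mul_nonneg hr.le (not_lt.mp h)))
  refine ⟨α⁻¹ • f.comp (ContinuousLinearMap.inr ℝ ℝ (Fin nG → ℝ)), fun u σ hV => ?_⟩
  set a := c (P.terminal u - P.terminal z.2.1) + (P.slackCost σ - P.slackCost z.2.2) with ha
  set b := f (0, P.G (P.terminal u)) with hb
  have h2 : -(α⁻¹ * b) ≤ a := by
    refine le_of_forall_gt_imp_ge_of_dense fun s hs => ?_
    have h3 := hf' (s, P.G (P.terminal u)) ⟨u, σ, hV, rfl, hs⟩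
    rw [hdec] at h3
    have h4 := mul_nonneg_of_nonpos_of_nonpos (inv_nonpos.mpr hα0.le) h3
    rw [mul_add, mul_left_comm, inv_mul_cancel₀ hα0.ne, mul_one] at h4
    linarith
  have h5 : (α⁻¹ • f.comp (ContinuousLinearMap.inr ℝ ℝ (Fin nG → ℝ))) (P.G (P.terminal u)) =
      α⁻¹ * b := rfl
  rw [h5]
  linarith

/-- The maximum principle: an adjoint vector `η` such that the optimal controls and slacks
minimize a Hamiltonian pointwise, and which vanishes only if the final state minimizes the
terminal cost. -/
theorem IsOptimal.exists_adjoint {P : RelaxedProblem n nu nG N} (hconv : P.IsConvex)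
    (hm : Differentiable ℝ P.m) (hslater : P.ControlSlater) {z : Traj n nu N}
    (hz : P.IsOptimal z) :
    ∃ η : Fin n → ℝ,
      (∀ i : Fin N, ∀ v s, (v, s) ∈ P.V →
        dotProduct (Matrix.vecMul η (P.A ^ (N - 1 - (i : ℕ)) * P.B)) (z.2.1 i) +
          P.l i (z.2.2 i) ≤
        dotProduct (Matrix.vecMul η (P.A ^ (N - 1 - (i : ℕ)) * P.B)) v + P.l i s) ∧
      (η = 0 → P.SolvesTerminal (P.terminal z.2.1)) := by
  have hc := (hm (P.terminal z.2.1)).hasFDerivAt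
  set c := fderiv ℝ P.m (P.terminal z.2.1)
  obtain ⟨ν, hν⟩ := hz.exists_multiplier hconv hslater hc
  have hG0 := G_terminal_eq_zero hz.1.1
  have hG : ∀ y, P.G y = P.G.linear (y - P.terminal z.2.1) := by
    intro y
    rw [← vsub_eq_sub, AffineMap.linearMap_vsub, hG0, vsub_eq_sub, sub_zero]
  -- The gradient of the Lagrangian with respect to the final state; its coordinates are η.
  set φ : (Fin n → ℝ) →ₗ[ℝ] ℝ := (c : (Fin n → ℝ) →ₗ[ℝ] ℝ) +
    (ν : (Fin nG → ℝ) →ₗ[ℝ] ℝ).comp P.G.linear with hφ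
  have hφa : ∀ y, φ y = c y + ν (P.G.linear y) := fun y => rfl
  have hη : ∀ y, dotProduct (fun i => φ (Pi.single i 1)) y = φ y := by
    intro y
    rw [LinearMap.pi_apply_eq_sum_univ φ y]
    refine Finset.sum_congr rfl fun i _ => ?_
    rw [smul_eq_mul, mul_comm]
    congr 1
    refine congrArg φ (funext fun j => ?_)
    simp [Pi.single_apply, eq_comm]
  refine ⟨fun i => φ (Pi.single i 1), fun i v s hvs => ?_, fun h0 => ?_⟩
  · rw [← Matrix.dotProduct_mulVec, ← Matrix.dotProduct_mulVec, hη, hη]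
    -- Only grid point i is varied. The competitor may break the terminal constraint, because the
    -- multiplier has absorbed it.
    have h1 := hν (Function.update z.2.1 i v) (Function.update z.2.2 i s) (by
      intro j
      by_cases hj : j = i
      · subst hj; simpa using hvs
      · rw [Function.update_of_ne hj, Function.update_of_ne hj]; exact hz.1.2 j)
    have h2 : Function.update z.2.1 i v - z.2.1 = Pi.single i (v - z.2.1 i) := by
      funext j
      by_cases hj : j = i
      · subst hj; simp
      · simp [hj]
    have h3 : P.slackCost (Function.update z.2.2 i s) - P.slackCost z.2.2 =
        P.l i s - P.l i (z.2.2 i) := by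
      unfold slackCost
      rw [← Finset.sum_sub_distrib, Finset.sum_eq_single i]
      · rw [Function.update_self]
      · intro j _ hj; rw [Function.update_of_ne hj, sub_self]
      · simp
    rw [hG, ← hφa, h3, P.terminal_sub, h2, reach_single, Matrix.mulVec_sub, map_sub] at h1
    linarith
  · refine ⟨hG0, fun y hy => ?_⟩
    -- If η = 0, the derivative of m vanishes along G = 0, and convexity turns stationarity into
    -- minimality.
    have h1 := hconv.1.fderiv_le_sub hc y
    have h2 : φ (y - P.terminal z.2.1) = 0 := by rw [← hη, h0, zero_dotProduct]
    rw [hφa, ← hG, hy, map_zero, add_zero] at h2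
    linarith

/-- At a grid point where the original constraint is violated, the switching function vanishes. -/
theorem eq_zero_of_violation {P : RelaxedProblem n nu nG N} (hconv : P.IsConvex)
    {p u : Fin nu → ℝ} {s : ℝ} (hV : (u, s) ∈ P.V)
    (hmin : ∀ v, (v, s) ∈ P.V → dotProduct p u ≤ dotProduct p v)
    (hviol : ¬ (P.rhoMin ≤ P.g u ∧ P.g u ≤ P.rhoMax)) : p = 0 := by
  -- The slack s lies in [ρ_min, ρ_max], so equality would mean no violation. Below, a short step
  -- along -p stays admissible and would lower the cost unless p = 0.
  have hlt : P.g u < s := by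
    by_contra h
    have h1 : P.g u = s := le_antisymm hV.2.2 (not_lt.mp h)
    exact hviol (h1 ▸ ⟨hV.1, hV.2.1⟩)
  have hc : Continuous fun t : ℝ => P.g (u - t • p) := hconv.continuous_g.comp (by fun_prop)
  have hev : ∀ᶠ t in nhdsWithin (0 : ℝ) (Set.Ioi 0), P.g (u - t • p) < s := by
    refine Filter.Eventually.filter_mono nhdsWithin_le_nhds ?_
    exact hc.continuousAt.eventually_lt continuousAt_const (by simpa using hlt)
  obtain ⟨t, ht, ht0⟩ := (hev.and self_mem_nhdsWithin).exists
  have h1 := hmin (u - t • p) ⟨hV.1, hV.2.1, ht.le⟩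
  rw [dotProduct_sub, dotProduct_smul, smul_eq_mul] at h1
  have h2 : dotProduct p p ≤ 0 := by
    by_contra h
    have := mul_pos ht0 (not_le.mp h)
    linarith
  exact dotProduct_self_eq_zero.mp (le_antisymm h2
    (Finset.sum_nonneg fun i _ => mul_self_nonneg _))

/-- In a normal problem, the powers of the dynamics matrix belonging to `n` violated grid points
do not span the whole space. -/
theorem IsOptimal.gramDet_eq_zero {P : RelaxedProblem n nu nG N} (hconv : P.IsConvex)
    (hreg : P.RegularCompact) (hslater : P.ControlSlater) (hnormal : ¬ P.Abnormal)
    {z : Traj n nu N} (hz : P.IsOptimal z) {k : Fin n → Fin N}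
    (hk : ∀ i, k i ∈ P.violations z) :
    gramDet (fun i => P.A ^ (N - 1 - (k i : ℕ)) * P.B) = 0 := by
  by_contra hne
  rw [← ne_eq, gramDet_ne_zero_iff] at hne
  obtain ⟨η, hmin, hT⟩ := hz.exists_adjoint hconv
    (hreg.2.2.1.differentiable one_ne_zero) hslater
  have hη : η = 0 := by
    refine hne η fun i => ?_
    refine eq_zero_of_violation hconv (hz.1.2 (k i)) (fun v hv => ?_) (hk i)
    have := hmin (k i) v _ hv
    linarith
  subst hη
  refine hnormal ⟨z.2.1, fun i => ?_, hT rfl⟩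
  -- With η = 0, comparison with (w i, ρ_min) gives l_i(σ_i) ≤ l_i(ρ_min), and strict monotonicity
  -- forces σ_i ≤ ρ_min.
  obtain ⟨w, hw⟩ := hreg.2.2.2.1
  have hV := hz.1.2 i
  have h1 := hmin i (w i) P.rhoMin ⟨le_rfl, hV.1.trans hV.2.1, hw i⟩
  simp only [Matrix.zero_vecMul, zero_dotProduct, zero_add] at h1
  have h2 := ((hreg.2.1 i).le_iff_le hV.1 Set.self_mem_Ici).mp h1
  exact hV.2.2.trans h2

theorem Slater.rhoMin_le {P : RelaxedProblem n nu nG N} (h : P.Slater) (hN : N ≠ 0) :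
    P.rhoMin ≤ P.rhoMax := by
  obtain ⟨z, hz, -⟩ := h
  have := interior_subset hz ⟨0, Nat.pos_of_ne_zero hN⟩
  exact this.1.trans this.2.1

end RelaxedProblem

/-! ### Choice of the cube and conclusion. -/

theorem isClosed_cube (d : ℕ) (ε : ℝ) : IsClosed (cube d ε) := by
  have : cube d ε = Set.Icc (fun _ => -ε) (fun _ => ε) := by
    ext q
    simp [cube, Pi.le_def, forall_and]
  rw [this]
  exact isClosed_Icc

theorem exists_cube_subset {d : ℕ} {p : (Fin d → ℝ) → Prop} (h : ∀ᶠ q in nhds 0, p q) :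
    ∃ ε : ℝ, 0 < ε ∧ ∀ q ∈ cube d ε, p q := by
  obtain ⟨ε, hε, hp⟩ := Metric.eventually_nhds_iff.mp h
  refine ⟨ε / 2, by positivity, fun q hq => hp ?_⟩
  rw [dist_zero_right]
  refine lt_of_le_of_lt ((pi_norm_le_iff_of_nonneg (by positivity)).mpr fun k => ?_)
    (half_lt_self hε)
  exact abs_le.mpr (hq k)

theorem mainTheorem1 {n nu nG N d : ℕ} (P : RelaxedProblem n nu nG N)
    (F : JordanForm P.A d)
    (hconv : P.IsConvex) (hreg : P.RegularCompact) (hctrl : P.Controllable)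
    (hrank : P.FullRowRank) (hslater : P.Slater) (hnormal : P.Normal) :
    ∃ ε : ℝ, 0 < ε ∧
      (∀ q ∈ cube d ε, ∃ z, (P.withDynamics (F.perturb q)).IsOptimal z) ∧
      uniformCube d ε
        {q | ∃ z, (P.withDynamics (F.perturb q)).IsOptimal z ∧
          (n : ℤ) - 1 < ((P.violations z).ncard : ℤ)} = 0 := by
  have hA1 := RelaxedProblem.eventually_controlSlater hrank hslater
  have hA2 := RelaxedProblem.eventually_not_abnormal hconv hreg hslater.rhoMin_le
    (hnormal.not_abnormal hreg hslater.rhoMin_le)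
  have hA3 : ∀ᶠ A' in nhds P.A, gramDet (fun i : Fin n => A' ^ (i : ℕ) * P.B) ≠ 0 :=
    (continuous_gramDet fun i : Fin n => (continuous_id.pow (i : ℕ)).matrix_mul
      continuous_const).continuousAt.eventually_ne hctrl.gramDet_ne_zero
  have hF : Filter.Tendsto F.perturb (nhds 0) (nhds P.A) := by
    have := F.continuous_perturb.tendsto 0
    rwa [F.perturb_zero] at this
  obtain ⟨ε, hε, hcube⟩ := exists_cube_subset (hF.eventually (hA1.and (hA2.and hA3)))
  refine ⟨ε, hε, fun q hq => RelaxedProblem.exists_isOptimal hconv hreg (hcube q hq).1, ?_⟩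
  -- There are finitely many selections of n distinct grid points, so one null set serves them all.
  have hae : ∀ᵐ q, ∀ k : {k : Fin n → Fin N // Function.Injective k}, q ∈ cube d ε →
      gramDet (fun i => F.perturb q ^ (N - 1 - (k.1 i : ℕ)) * P.B) ≠ 0 := by
    rw [MeasureTheory.ae_all_iff]
    intro k
    refine F.ae_gramDet_ne_zero P.B (isClosed_cube d ε) (fun q hq => (hcube q hq).2.2) ?_
    intro i j hij
    have hi := (k.1 i).2
    have hj := (k.1 j).2
    -- Every index is below N, so the truncated exponents N - 1 - k remain distinct.
    exact k.2 (Fin.ext (by dsimp only at hij; omega))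
  rw [uniformCube, ProbabilityTheory.cond_apply (isClosed_cube d ε).measurableSet]
  refine mul_eq_zero_of_right _ (MeasureTheory.measure_mono_null ?_ hae)
  rintro q ⟨hq, z, hz, hcard⟩ hgood
  have hle : n ≤ (P.violations z).ncard := by omega
  have hcard' : Fintype.card (Fin n) ≤ Nat.card (P.violations z) := by
    rw [Fintype.card_fin, Nat.card_coe_set_eq]; exact hle
  classical
  rw [Nat.card_eq_fintype_card] at hcard'
  obtain ⟨e⟩ := Function.Embedding.nonempty_of_card_le hcard'
  refine hgood ⟨fun i => (e i : Fin N), fun i j hij => e.injective (Subtype.ext hij)⟩ hq ?_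
  exact RelaxedProblem.IsOptimal.gramDet_eq_zero (P := P.withDynamics (F.perturb q)) hconv hreg
    (hcube q hq).1 (hcube q hq).2.1 hz fun i => (e i).2

end
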